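/- Let $q$ be a prime power and $V=\mathbb{F}_q^v$. The subspace distance of $U,W\le V$ is $d_S(U,W)=\dim(U+W)-\dim(U\cap W)$. A $(v,M,d;k)_q$ constant dimension code (CDC) is a set $C$ of $M$ subspaces of $\mathbb{F}_q^v$, all of dimension $k$, with $d_S(U,W)\ge d$ for all $U\ne W$ in $C$; the maximum possible $M$ is denoted by $A_q(v,d;k)$. For an even $d$ with $2\le d/2\le k\le v/2$, an LMRD code with parameters $(v,d;k)_q$ is a set $\{\operatorname{rowspan}(I_k\mid A): A\in R\}$, where $R$ is an $\mathbb{F}_q$-linear maximum rank distance code, i.e. a linear subspace $R$ of $\mathbb{F}_q^{k\times(v-k)}$ of cardinality $q^{(v-k)(k-d/2+1)}$ such that $\operatorname{rk}(A-B)\ge d/2$ for all $A\ne B$ in $R$. **Lemma.** Let $l\ge 1$ be an integer and $q$ a prime power. Then there is a $(6+3l,\;q^{6+4l}+q^{2+l}+1,\;4+2l;\;3+l)_q$ CDC that contains an LMRD code with parameters $(6+3l,4+2l;3+l)_q$. Its cardinality achieves the LMRD bound: with $v=6+3l$, $d=4+2l$, $k=3+l$, every $(v,M,d;k)_q$ CDC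 that contains an LMRD code with parameters $(v,d;k)_q$ satisfies $$M\le q^{(v-k)(k-d/2+1)}+A_q(v-k,2(d-k);d/2),$$ and the right-hand side equals $q^{6+4l}+q^{2+l}+1$, where $A_q(v-k,2(d-k);d/2)=A_q(3+2l,2+2l;2+l)=q^{2+l}+1$. -/

import Mathlib

namespace SubspaceCode

variable (F : Type*) [Field F]

/-- The subspace distance `dim (U + W) - dim (U ∩ W)`. (In a finite-dimensional space the natural
number subtraction does not truncate, as `U ∩ W ≤ U + W`.) -/
noncomputable def subspaceDist {v : ℕ} (U W : Submodule F (Fin v → F)) : ℕ :=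
  Module.finrank F ↥(U ⊔ W) - Module.finrank F ↥(U ⊓ W)

/-- `C` is a `(v, M, d; k)_q` constant dimension code in `F ^ v`, where `q` is the order of `F`. -/
structure IsCDC (v M d k : ℕ) (C : Set (Submodule F (Fin v → F))) : Prop where
  finrank_eq : ∀ U ∈ C, Module.finrank F U = k
  ncard_eq : C.ncard = M
  le_dist : ∀ U ∈ C, ∀ W ∈ C, U ≠ W → d ≤ subspaceDist F U W

/-- `A_q(v, d; k)`: the maximum cardinality of a constant dimension code in `F ^ v` with codewords
of dimension `k` and minimum subspace distance at least `d`, where `q` is the order of `F`. -/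
noncomputable def maxCDC (v d k : ℕ) : ℕ :=
  sSup {M : ℕ | ∃ C : Set (Submodule F (Fin v → F)), IsCDC F v M d k C}

/-- Over a finite field the supremum in `maxCDC` is a maximum. -/
theorem isGreatest_maxCDC [Finite F] (v d k : ℕ) :
    IsGreatest {M : ℕ | ∃ C : Set (Submodule F (Fin v → F)), IsCDC F v M d k C}
      (maxCDC F v d k) := by
  have hfin : Finite (Submodule F (Fin v → F)) :=
    Finite.of_injective (fun U => (U : Set (Fin v → F))) SetLike.coe_injective
  have hne : {M : ℕ | ∃ C : Set (Submodule F (Fin v → F)), IsCDC F v M d k C}.Nonempty :=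
    ⟨0, ∅, by simp, by simp, by simp⟩
  have hbdd : BddAbove {M : ℕ | ∃ C : Set (Submodule F (Fin v → F)), IsCDC F v M d k C} := by
    refine ⟨(Set.univ : Set (Submodule F (Fin v → F))).ncard, ?_⟩
    rintro M ⟨C, hC⟩
    rw [← hC.ncard_eq]
    exact Set.ncard_le_ncard (Set.subset_univ C) (Set.toFinite _)
  exact ⟨Nat.sSup_mem hne hbdd, fun M hM => le_csSup hbdd hM⟩

/-- The linear code `R` of `m × n` matrices is an `[m × n, M, d]_q` rank metric code. -/
structure IsRankMetricCode (m n M d : ℕ) (R : Submodule F (Matrix (Fin m) (Fin n) F)) : Prop where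
  card_eq : Nat.card R = M
  le_rank : ∀ A ∈ R, ∀ B ∈ R, A ≠ B → d ≤ (A - B).rank

/-- `R` is a linear maximum rank distance code of `m × n` matrices with minimum rank distance at
least `d`, i.e. its cardinality is `⌈q ^ (max m n * (min m n - d + 1))⌉`. (For `d ≥ 1`, truncated
subtraction gives exactly this: if `min m n < d`, both expressions are `1`.) -/
def IsMRD (m n d : ℕ) (R : Submodule F (Matrix (Fin m) (Fin n) F)) : Prop :=
  IsRankMetricCode F m n (Nat.card F ^ (max m n * (min m n + 1 - d))) d R

variable {F} in
/-- The `k × v` matrix `(I_k | A)`, for a `k × (v - k)` matrix `A` and `k ≤ v`. -/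
def identityPrefix (v k : ℕ) (A : Matrix (Fin k) (Fin (v - k)) F) : Matrix (Fin k) (Fin v) F :=
  fun i j =>
    if h : (j : ℕ) < k then (1 : Matrix (Fin k) (Fin k) F) i ⟨j, h⟩
    else A i ⟨(j : ℕ) - k, by have := j.isLt; omega⟩

variable {F} in
/-- The span of the rows of a matrix. -/
def rowSpan {m n : ℕ} (A : Matrix (Fin m) (Fin n) F) : Submodule F (Fin n → F) :=
  Submodule.span F (Set.range fun i => A i)

/-- `L` is a lifted maximum rank distance code in `F ^ v` for even minimum subspace distance `d` and
codeword dimension `k`: the set of all row spans of `(I_k | A)`, where `A` runs through a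
`k × (v - k)` maximum rank distance code with minimum rank distance at least `d / 2`. -/
def IsLMRD (v d k : ℕ) (L : Set (Submodule F (Fin v → F))) : Prop :=
  ∃ R : Submodule F (Matrix (Fin k) (Fin (v - k)) F),
    IsMRD F k (v - k) (d / 2) R ∧
      L = {U | ∃ A ∈ R, U = rowSpan (identityPrefix v k A)}

/-- The LMRD bound `q ^ ((v - k) (k - d/2 + 1)) + A_q(v - k, 2 (d - k); d/2)`, which is meant for
even `d` with `2 ≤ d/2 ≤ k ≤ v/2` and `k < d ≤ 2v/3`. -/
noncomputable def lmrdBound (v d k : ℕ) : ℕ :=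
  Nat.card F ^ ((v - k) * (k - d / 2 + 1)) + maxCDC F (v - k) (2 * (d - k)) (d / 2)

end SubspaceCode

namespace SubspaceCode

variable {F : Type*} [Field F]

/-! Put `k = 3 + l`, `n = v - k = 3 + 2 l` and `m = l + 1`, so that `d / 2 = k - 1 = m + 1` and `n =
2 m + 1`. Two codewords are far enough apart iff they meet in dimension at most 1. In `F ^ k × F ^
n`, lifted matrices are graphs of maps `x ↦ x A`.

Construction: the graphs of a Gabidulin code (`exists_isMRD`) give `q ^ (2 n)` codewords. Add the
products `P × W`, with `W` running through `q ^ (m + 1) + 1` subspaces of dimension `m + 1` that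
pairwise meet in a line (`exists_isCDC_dual_spread`) and `P` through distinct points of `F ^ k`. A
graph meets `P × W` in something that projects injectively to `P`; two products meet in `0 × (W ∩
W')`.

Bound: every subspace of dimension `k - d/2 + 1` that projects injectively to `F ^ k` lies in a
lifted codeword. Any further codeword must therefore meet `0 × F ^ n` in dimension at least `d/2`,
and these intersections yield a code in `F ^ n` (`IsCDC.le_lmrdBound`). Its maximal size is found by
counting in the dual space, where the subspaces become a partial spread (`card_le_of_sup_eq_top`).
-/

theorem subspaceDist_add_two_mul_finrank_inf {v k : ℕ} {U W : Submodule F (Fin v → F)}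
    (hU : Module.finrank F U = k) (hW : Module.finrank F W = k) :
    subspaceDist F U W + 2 * Module.finrank F ↥(U ⊓ W) = 2 * k := by
  have h1 := Submodule.finrank_sup_add_finrank_inf_eq U W
  have h2 : Module.finrank F ↥(U ⊓ W) ≤ Module.finrank F U := Submodule.finrank_mono inf_le_left
  unfold subspaceDist
  omega

/-- A family of `k`-dimensional subspaces which pairwise meet in dimension at most `t < k` is
injective and forms a constant dimension code. -/
theorem isCDC_range {ι : Type*} {v k t M : ℕ} (f : ι → Submodule F (Fin v → F))
    (hf : ∀ i, Module.finrank F (f i) = k)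
    (hinf : ∀ i j, i ≠ j → Module.finrank F ↥(f i ⊓ f j) ≤ t) (htk : t < k)
    (hM : Nat.card ι = M) : IsCDC F v M (2 * (k - t)) k (Set.range f) := by
  refine ⟨?_, ?_, ?_⟩
  · rintro _ ⟨i, rfl⟩
    exact hf i
  · have hinj : Function.Injective f := by
      intro i j hij
      by_contra hne
      have h1 := hinf i j hne
      rw [hij, inf_idem, hf j] at h1
      omega
    rw [← Set.image_univ, Set.ncard_image_of_injective _ hinj, Set.ncard_univ, hM]
  · rintro _ ⟨i, rfl⟩ _ ⟨j, rfl⟩ hne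
    have h1 := hinf i j (fun h => hne (h ▸ rfl))
    have h2 := subspaceDist_add_two_mul_finrank_inf (hf i) (hf j)
    omega

/-! ### Dimensions of subspaces, products and graphs -/

theorem exists_submodule_finrank_eq {V : Type*} [AddCommGroup V] [Module F V]
    [FiniteDimensional F V] {t : ℕ} (ht : t ≤ Module.finrank F V) :
    ∃ T : Submodule F V, Module.finrank F T = t := by
  refine ⟨Submodule.span F (Set.range fun i : Fin t => Module.finBasis F V (Fin.castLE ht i)), ?_⟩
  rw [finrank_span_eq_card, Fintype.card_fin]
  exact (Module.finBasis F V).linearIndependent.comp _ (Fin.castLE_injective ht)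

theorem exists_le_finrank_eq {V : Type*} [AddCommGroup V] [Module F V]
    [FiniteDimensional F V] (U : Submodule F V) {t : ℕ} (ht : t ≤ Module.finrank F U) :
    ∃ T ≤ U, Module.finrank F T = t := by
  obtain ⟨T, hT⟩ := exists_submodule_finrank_eq ht
  exact ⟨T.map U.subtype, Submodule.map_subtype_le U T, by
    rw [Submodule.finrank_map_subtype_eq, hT]⟩

/-- A linear map injective on a subspace does not lower its dimension. -/
theorem finrank_le_of_injOn {V W : Type*} [AddCommGroup V] [Module F V] [AddCommGroup W]
    [Module F W] [FiniteDimensional F W] (f : V →ₗ[F] W) (U : Submodule F V) (T : Submodule F W)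
    (hmap : ∀ x ∈ U, f x ∈ T) (hinj : ∀ x ∈ U, f x = 0 → x = 0) :
    Module.finrank F U ≤ Module.finrank F T := by
  refine LinearMap.finrank_le_finrank_of_injective (f := f.restrict hmap) ?_
  rw [injective_iff_map_eq_zero]
  intro x hx
  exact Subtype.ext (hinj x x.2 (congrArg Subtype.val hx))

theorem finrank_submodule_prod {V W : Type*} [AddCommGroup V] [Module F V] [AddCommGroup W]
    [Module F W] [FiniteDimensional F V] [FiniteDimensional F W] (U : Submodule F V)
    (T : Submodule F W) :
    Module.finrank F (U.prod T) = Module.finrank F U + Module.finrank F T := by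
  have hrange : U.prod T = LinearMap.range (U.subtype.prodMap T.subtype) := by
    rw [LinearMap.range_eq_map, ← Submodule.prod_top, LinearMap.prodMap_map_prod,
      Submodule.map_subtype_top, Submodule.map_subtype_top]
  rw [hrange, LinearMap.finrank_range_of_inj
    (Function.Injective.prodMap U.subtype_injective T.subtype_injective), Module.finrank_prod]

theorem finrank_graph {V W : Type*} [AddCommGroup V] [Module F V] [AddCommGroup W]
    [Module F W] [FiniteDimensional F V] [FiniteDimensional F W] (f : V →ₗ[F] W) :
    Module.finrank F f.graph = Module.finrank F V := by
  rw [LinearMap.graph_eq_range_prod]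
  exact LinearMap.finrank_range_of_inj fun x y h => congrArg Prod.fst h

/-- The first projection is injective on a graph, and a common point of both graphs lies over an `x`
with `f x = g x`. -/
theorem finrank_graph_inf_graph_le {V W : Type*} [AddCommGroup V] [Module F V] [AddCommGroup W]
    [Module F W] [FiniteDimensional F V] (f g : V →ₗ[F] W) :
    Module.finrank F ↥(f.graph ⊓ g.graph) ≤ Module.finrank F (LinearMap.ker (f - g)) := by
  refine finrank_le_of_injOn (LinearMap.fst F V W) _ _ ?_ ?_
  · rintro ⟨x, y⟩ ⟨h1, h2⟩
    simp only [SetLike.mem_coe, LinearMap.mem_graph_iff] at h1 h2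
    simp [← h1, ← h2]
  · rintro ⟨x, y⟩ ⟨h1, h2⟩ hx
    simp only [SetLike.mem_coe, LinearMap.mem_graph_iff] at h1 h2
    simp only [LinearMap.fst_apply] at hx
    simp [h1, hx]

theorem finrank_graph_inf_prod_le {V W : Type*} [AddCommGroup V] [Module F V] [AddCommGroup W]
    [Module F W] [FiniteDimensional F V] (f : V →ₗ[F] W) (U : Submodule F V)
    (T : Submodule F W) :
    Module.finrank F ↥(f.graph ⊓ U.prod T) ≤ Module.finrank F U := by
  refine finrank_le_of_injOn (LinearMap.fst F V W) _ _ ?_ ?_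
  · rintro ⟨x, y⟩ ⟨h1, h2⟩
    exact (Submodule.mem_prod.1 h2).1
  · rintro ⟨x, y⟩ ⟨h1, h2⟩ hx
    simp only [SetLike.mem_coe, LinearMap.mem_graph_iff] at h1
    simp only [LinearMap.fst_apply] at hx
    simp [h1, hx]

theorem finrank_comap_equiv {V W : Type*} [AddCommGroup V] [Module F V] [AddCommGroup W]
    [Module F W] (e : V ≃ₗ[F] W) (T : Submodule F W) :
    Module.finrank F (T.comap e.toLinearMap) = Module.finrank F T := by
  rw [Submodule.comap_equiv_eq_map_symm]
  exact LinearEquiv.finrank_map_eq e.symm T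

theorem rank_add_finrank_ker_vecMulLinear {k n : ℕ} (A : Matrix (Fin k) (Fin n) F) :
    A.rank + Module.finrank F (LinearMap.ker A.vecMulLinear) = k := by
  rw [Matrix.rank_eq_finrank_span_row, ← range_vecMulLinear,
    LinearMap.finrank_range_add_finrank_ker, Module.finrank_fin_fun]

/-- The splitting of `F ^ v` into the first `k` and the last `v - k` coordinates. -/
def splitAt {v k : ℕ} (hk : k ≤ v) : (Fin v → F) ≃ₗ[F] (Fin k → F) × (Fin (v - k) → F) where
  toFun x := (fun i => x ⟨i, by omega⟩, fun j => x ⟨k + j, by omega⟩)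
  map_add' x y := rfl
  map_smul' c x := rfl
  invFun p i := if h : (i : ℕ) < k then p.1 ⟨i, h⟩ else p.2 ⟨i - k, by omega⟩
  left_inv x := by
    funext i
    by_cases h : (i : ℕ) < k
    · simp [h]
    · simp only [h, dite_false]
      congr 1
      ext
      simp only
      omega
  right_inv p := by
    ext i
    · simp
    · simp

/-- Multiplying a row vector `x` by `(I_k | A)` gives `(x, x A)`. This turns questions about
codewords into questions about graphs. -/
theorem rowSpan_identityPrefix {v k : ℕ} (hk : k ≤ v) (A : Matrix (Fin k) (Fin (v - k)) F) :
    rowSpan (identityPrefix v k A) =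
      A.vecMulLinear.graph.comap (splitAt (F := F) hk).toLinearMap := by
  have hrow : ∀ x : Fin k → F, splitAt hk ((identityPrefix v k A).vecMulLinear x) =
      (x, A.vecMulLinear x) := by
    intro x
    ext i
    · simp only [splitAt, identityPrefix, LinearEquiv.coe_mk, LinearMap.coe_mk, AddHom.coe_mk,
        Matrix.vecMulLinear_apply, Matrix.vecMul, dotProduct]
      simp [Matrix.one_apply]
    · simp only [splitAt, identityPrefix, LinearEquiv.coe_mk, LinearMap.coe_mk, AddHom.coe_mk,
        Matrix.vecMulLinear_apply, Matrix.vecMul, dotProduct]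
      simp
  have hspan : rowSpan (identityPrefix v k A) =
      LinearMap.range (identityPrefix v k A).vecMulLinear :=
    (range_vecMulLinear _).symm
  rw [hspan]
  ext y
  simp only [LinearMap.mem_range, Submodule.mem_comap, LinearEquiv.coe_coe,
    LinearMap.mem_graph_iff]
  constructor
  · rintro ⟨x, rfl⟩
    rw [hrow]
  · intro h
    refine ⟨(splitAt hk y).1, (splitAt hk).injective ?_⟩
    rw [hrow]
    exact Prod.ext rfl h.symm

/-! ### Gabidulin codes from linearized binomials -/

/-- Every finite field has an extension of any positive degree. -/
theorem exists_extension_finrank_eq (F : Type*) [Field F] [Finite F] (n : ℕ) (hn : 0 < n) :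
    ∃ (K : Type) (_ : Field K) (_ : Algebra F K), Finite K ∧ Module.finrank F K = n := by
  obtain ⟨p, hp⟩ := CharP.exists F
  have : Fact p.Prime := ⟨CharP.char_is_prime F p⟩
  have : NeZero n := ⟨hn.ne'⟩
  exact ⟨FiniteField.Extension F p n, inferInstance, inferInstance, inferInstance,
    FiniteField.finrank_extension F p n⟩

section LinearizedBinomial

variable {K : Type*} [Field K] [Algebra F K]

/-- The linearized binomial `z ↦ a z + b z ^ q`, where `q` is the order of `F`. -/
noncomputable def linearizedBinomial (F : Type*) [Field F] [Fintype F] {K : Type*} [Field K]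
    [Algebra F K] : K × K →ₗ[F] K →ₗ[F] K :=
  LinearMap.coprod (LinearMap.mul F K)
    ((LinearMap.lcomp F K (FiniteField.frobeniusAlgHom F K).toLinearMap).comp (LinearMap.mul F K))

theorem linearizedBinomial_apply [Fintype F] (p : K × K) (z : K) :
    linearizedBinomial F p z = p.1 * z + p.2 * z ^ Fintype.card F := by
  simp [linearizedBinomial]

/-- The kernel consists of roots of a nonzero polynomial of degree at most `q`, so it has at most
`q` elements. -/
theorem finrank_ker_linearizedBinomial_le [Fintype F] [Finite K] (p : K × K) (hp : p ≠ 0) :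
    Module.finrank F (LinearMap.ker (linearizedBinomial F p)) ≤ 1 := by
  classical
  have hq : 1 < Fintype.card F := Fintype.one_lt_card
  let f : Polynomial K := Polynomial.C p.1 * Polynomial.X +
    Polynomial.C p.2 * Polynomial.X ^ Fintype.card F
  have hf : f ≠ 0 := by
    intro h
    apply hp
    have h1 : f.coeff 1 = 0 := by rw [h, Polynomial.coeff_zero]
    have h2 : f.coeff (Fintype.card F) = 0 := by rw [h, Polynomial.coeff_zero]
    simp only [f, Polynomial.coeff_add, Polynomial.coeff_C_mul, Polynomial.coeff_X,
      Polynomial.coeff_X_pow] at h1 h2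
    rw [if_neg hq.ne] at h1
    rw [if_neg hq.ne] at h2
    exact Prod.ext (by simpa using h1) (by simpa using h2)
  have hdeg : f.natDegree ≤ Fintype.card F := by
    refine Polynomial.natDegree_add_le_of_degree_le ?_ (Polynomial.natDegree_C_mul_X_pow_le _ _)
    exact (Polynomial.natDegree_C_mul_le _ _).trans (Polynomial.natDegree_X_le.trans hq.le)
  have hsub : ((LinearMap.ker (linearizedBinomial F p) : Submodule F K) : Set K) ⊆
      (f.roots.toFinset : Set K) := by
    intro z hz
    have hz' : linearizedBinomial F p z = 0 := hz
    rw [linearizedBinomial_apply] at hz'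
    simp only [Finset.mem_coe, Multiset.mem_toFinset, Polynomial.mem_roots hf, Polynomial.IsRoot]
    simpa [f] using hz'
  have hcard : Nat.card (LinearMap.ker (linearizedBinomial F p)) ≤ Fintype.card F := by
    calc Nat.card (LinearMap.ker (linearizedBinomial F p))
        = ((LinearMap.ker (linearizedBinomial F p) : Submodule F K) : Set K).ncard := rfl
      _ ≤ (f.roots.toFinset : Set K).ncard := Set.ncard_le_ncard hsub (Finset.finite_toSet _)
      _ = f.roots.toFinset.card := Set.ncard_coe_finset _
      _ ≤ f.natDegree := (Multiset.toFinset_card_le _).trans f.card_roots'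
      _ ≤ Fintype.card F := hdeg
  rw [Module.natCard_eq_pow_finrank (K := F), Nat.card_eq_fintype_card] at hcard
  exact (Nat.pow_le_pow_iff_right hq).1 (by simpa using hcard)

end LinearizedBinomial

/-- A Gabidulin code: for `2 ≤ k ≤ n` there are linear maximum rank distance codes with minimum
rank distance `k - 1`. -/
theorem exists_isMRD (F : Type*) [Field F] [Finite F] {k n : ℕ} (hk : 2 ≤ k) (hkn : k ≤ n) :
    ∃ R : Submodule F (Matrix (Fin k) (Fin n) F), IsMRD F k n (k - 1) R := by
  have := Fintype.ofFinite F
  obtain ⟨K, _, _, _, hK⟩ := exists_extension_finrank_eq F n (by omega)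
  let b : Module.Basis (Fin n) F K := Module.finBasisOfFinrankEq F K hK
  let e : (Fin k → F) →ₗ[F] K := Fintype.linearCombination F fun i => b (Fin.castLE hkn i)
  have he : Function.Injective e :=
    LinearIndependent.fintypeLinearCombination_injective
      (b.linearIndependent.comp _ (Fin.castLE_injective hkn))
  let φ : K × K →ₗ[F] Matrix (Fin k) (Fin n) F :=
    LinearMap.pi fun i => b.equivFun.toLinearMap.comp
      ((linearizedBinomial F).flip (b (Fin.castLE hkn i)))
  -- `φ p` is the matrix of the binomial restricted to the span of the first `k` basis vectors, so
  -- its left kernel embeds in that of the binomial.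
  have hvec : ∀ (p : K × K) (x : Fin k → F),
      (φ p).vecMulLinear x = b.equivFun (linearizedBinomial F p (e x)) := by
    intro p x
    simp only [e, Fintype.linearCombination_apply, map_sum, map_smul, Matrix.vecMulLinear_apply]
    ext j
    simp only [Matrix.vecMul, dotProduct, Finset.sum_apply, Pi.smul_apply, smul_eq_mul]
    rfl
  have hrank : ∀ p : K × K, p ≠ 0 → k - 1 ≤ (φ p).rank := by
    intro p hp
    have h1 := rank_add_finrank_ker_vecMulLinear (φ p)
    have h2 : Module.finrank F (LinearMap.ker (φ p).vecMulLinear) ≤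
        Module.finrank F (LinearMap.ker (linearizedBinomial F p)) := by
      refine finrank_le_of_injOn e _ _ ?_ ?_
      · intro x hx
        have hx' : (φ p).vecMulLinear x = 0 := hx
        rw [hvec] at hx'
        simpa using hx'
      · intro x _ hx
        exact he (hx.trans (map_zero e).symm)
    have h3 := finrank_ker_linearizedBinomial_le (F := F) p hp
    omega
  have hinj : Function.Injective φ := by
    rw [injective_iff_map_eq_zero]
    intro p hp
    by_contra hne
    have h1 := hrank p hne
    rw [hp, Matrix.rank_zero] at h1
    omega
  refine ⟨LinearMap.range φ, ?_, ?_⟩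
  · have hcard : Nat.card (LinearMap.range φ) = Nat.card (K × K) :=
      (Nat.card_congr (LinearEquiv.ofInjective φ hinj).toEquiv).symm
    rw [hcard, Nat.card_prod, Module.natCard_eq_pow_finrank (K := F) (V := K), hK, ← pow_add,
      max_eq_right hkn, min_eq_left hkn]
    congr 1
    -- The factor 2 in the MRD exponent matches the two free coefficients of a binomial.
    have h2 : k + 1 - (k - 1) = 2 := by omega
    rw [h2]
    omega
  · rintro _ ⟨p, rfl⟩ _ ⟨p', rfl⟩ hne
    rw [← map_sub]
    exact hrank (p - p') fun h => hne (by rw [sub_eq_zero.1 h])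

/-! ### The dual partial spread -/

/-- For `m ≥ 1` there are `q ^ (m + 1) + 1` subspaces of `F ^ (2 m + 1)` of dimension `m + 1` which
pairwise meet in dimension `1`. -/
theorem exists_isCDC_dual_spread (F : Type*) [Field F] [Finite F] {m : ℕ} (hm : 1 ≤ m) :
    ∃ C : Set (Submodule F (Fin (2 * m + 1) → F)),
      IsCDC F (2 * m + 1) (Nat.card F ^ (m + 1) + 1) (2 * m) (m + 1) C := by
  obtain ⟨K, _, _, _, hK⟩ := exists_extension_finrank_eq F (m + 1) (by omega)
  let b : Module.Basis (Fin (m + 1)) F K := Module.finBasisOfFinrankEq F K hK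
  let π : K →ₗ[F] (Fin m → F) := (LinearMap.funLeft F F Fin.succ).comp b.equivFun.toLinearMap
  have hπ : Module.finrank F (LinearMap.ker π) ≤ 1 := by
    have h1 := LinearMap.finrank_range_add_finrank_ker π
    have h2 : Function.Surjective π :=
      (LinearMap.funLeft_surjective_of_injective F F _ (Fin.succ_injective m)).comp
        b.equivFun.surjective
    rw [LinearMap.range_eq_top.2 h2, finrank_top] at h1
    simp only [Module.finrank_fin_fun, hK] at h1
    omega
  -- `g a - g c` is multiplication by the unit `a - c` followed by `π`, so its kernel is no larger
  -- than that of `π`.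
  let g : K → K →ₗ[F] (Fin m → F) := fun a => π.comp (LinearMap.mul F K a)
  have hg : ∀ a c, a ≠ c → Module.finrank F (LinearMap.ker (g a - g c)) ≤ 1 := by
    intro a c hac
    refine (finrank_le_of_injOn (LinearMap.mul F K (a - c)) _ _ ?_ ?_).trans hπ
    · intro x hx
      have hx' : π (a * x) - π (c * x) = 0 := hx
      simpa [sub_mul] using hx'
    · intro x _ hx
      have hx' : (a - c) * x = 0 := hx
      exact (mul_eq_zero.1 hx').resolve_left (sub_ne_zero.2 hac)
  have hline : Module.finrank F (Submodule.span F {(1 : K)}) = 1 := finrank_span_singleton one_ne_zero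
  let e : (Fin (2 * m + 1) → F) ≃ₗ[F] K × (Fin m → F) :=
    LinearEquiv.ofFinrankEq _ _ (by
      rw [Module.finrank_prod, hK, Module.finrank_fin_fun, Module.finrank_fin_fun]; omega)
  -- The extra member is a line times the whole second factor; it meets each graph only over that
  -- line.
  let f : Option K → Submodule F (K × (Fin m → F)) := fun o =>
    o.elim ((Submodule.span F {(1 : K)}).prod ⊤) fun a => (g a).graph
  have hCDC := isCDC_range (fun o => (f o).comap e.toLinearMap) (k := m + 1) (t := 1)
    (M := Nat.card F ^ (m + 1) + 1) ?_ ?_ (by omega) ?_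
  · exact ⟨_, by simpa using hCDC⟩
  · intro o
    rw [finrank_comap_equiv]
    cases o with
    | none =>
      change Module.finrank F ↥((Submodule.span F {(1 : K)}).prod (⊤ : Submodule F (Fin m → F))) = _
      rw [finrank_submodule_prod, hline, finrank_top, Module.finrank_fin_fun, add_comm]
    | some a => exact (finrank_graph (g a)).trans hK
  · intro o o' hne
    rw [← Submodule.comap_inf, finrank_comap_equiv]
    cases o with
    | none =>
      cases o' with
      | none => exact absurd rfl hne
      | some a =>
        rw [inf_comm]
        exact (finrank_graph_inf_prod_le _ _ _).trans hline.le
    | some a =>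
      cases o' with
      | none =>
        exact (finrank_graph_inf_prod_le _ _ _).trans hline.le
      | some c =>
        exact (finrank_graph_inf_graph_le _ _).trans (hg a c fun h => hne (by rw [h]))
  · rw [Finite.card_option, Module.natCard_eq_pow_finrank (K := F) (V := K), hK]

/-! ### Extending the lifted code -/

theorem projectivization_submodule_inf_eq_bot {V : Type*} [AddCommGroup V] [Module F V]
    {x y : Projectivization F V} (hxy : x ≠ y) : x.submodule ⊓ y.submodule = ⊥ := by
  rw [Submodule.eq_bot_iff]
  rintro z ⟨hx, hy⟩
  by_contra hz
  rw [Projectivization.submodule_eq] at hx hy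
  obtain ⟨a, ha⟩ := Submodule.mem_span_singleton.1 hx
  obtain ⟨b, hb⟩ := Submodule.mem_span_singleton.1 hy
  apply hxy
  have h1 : x = Projectivization.mk F z hz := by
    rw [← x.mk_rep, Projectivization.mk_eq_mk_iff']
    have ha0 : a ≠ 0 := by rintro rfl; exact hz (by rw [← ha, zero_smul])
    exact ⟨a⁻¹, by rw [← ha, inv_smul_smul₀ ha0]⟩
  have h2 : y = Projectivization.mk F z hz := by
    rw [← y.mk_rep, Projectivization.mk_eq_mk_iff']
    have hb0 : b ≠ 0 := by rintro rfl; exact hz (by rw [← hb, zero_smul])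
    exact ⟨b⁻¹, by rw [← hb, inv_smul_smul₀ hb0]⟩
  rw [h1, h2]

/-- There are enough points to attach a different one to each member of the dual spread: `1` and `q
^ r` are distinct terms of `1 + q + ... + q ^ r`. -/
theorem pow_add_one_le_card_projectivization (F : Type*) [Field F] [Finite F] {r : ℕ}
    (hr : 1 ≤ r) : Nat.card F ^ r + 1 ≤ Nat.card (Projectivization F (Fin (r + 1) → F)) := by
  rw [Projectivization.card_of_finrank F _ (n := r + 1) (by simp), Finset.sum_range_succ, add_comm]
  have h : ∑ i ∈ Finset.range 1, Nat.card F ^ i ≤ ∑ i ∈ Finset.range r, Nat.card F ^ i :=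
    Finset.sum_le_sum_of_subset (Finset.range_subset_range.2 hr)
  simp only [Finset.range_one, Finset.sum_singleton, pow_zero] at h
  omega

theorem finrank_ker_vecMulLinear_le_one {k n : ℕ} {A : Matrix (Fin k) (Fin n) F} (hA : k - 1 ≤ A.rank) :
    Module.finrank F (LinearMap.ker A.vecMulLinear) ≤ 1 := by
  have := rank_add_finrank_ker_vecMulLinear A
  omega

/-- A lifted maximum rank distance code with minimum rank distance `k - 1` is extended by the
products of distinct points of `F ^ k` and the members of a code of `(k - 1)`-dimensional subspaces
of `F ^ (v - k)` which pairwise meet in dimension at most `1`. -/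
theorem exists_isCDC_extending_isLMRD [Finite F] {v r N : ℕ} (hr : 1 ≤ r)
    (hv : r + 1 ≤ v - (r + 1)) {D : Set (Submodule F (Fin (v - (r + 1)) → F))}
    (hD : IsCDC F (v - (r + 1)) N (2 * (r - 1)) r D)
    (hN : N ≤ Nat.card (Projectivization F (Fin (r + 1) → F))) :
    ∃ C : Set (Submodule F (Fin v → F)),
      IsCDC F v (Nat.card F ^ (2 * (v - (r + 1))) + N) (2 * r) (r + 1) C ∧
        ∃ L ⊆ C, IsLMRD F v (2 * r) (r + 1) L := by
  have hkv : r + 1 ≤ v := by omega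
  obtain ⟨R, hR⟩ := exists_isMRD F (k := r + 1) (by omega) hv
  have hfin : Finite (Submodule F (Fin (v - (r + 1)) → F)) :=
    Finite.of_injective (fun U => (U : Set (Fin (v - (r + 1)) → F))) SetLike.coe_injective
  have : Finite (Projectivization F (Fin (r + 1) → F)) :=
    (Projectivization.finite_iff_of_finite F _).2 inferInstance
  have := Fintype.ofFinite (Projectivization F (Fin (r + 1) → F))
  have := Fintype.ofFinite D
  obtain ⟨ℓ⟩ : Nonempty (D ↪ Projectivization F (Fin (r + 1) → F)) := by
    apply Function.Embedding.nonempty_of_card_le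
    rw [← Nat.card_eq_fintype_card, ← Nat.card_eq_fintype_card, Nat.card_coe_set_eq, hD.ncard_eq]
    exact hN
  let e := splitAt (F := F) hkv
  let f : R ⊕ D → Submodule F ((Fin (r + 1) → F) × (Fin (v - (r + 1)) → F)) :=
    Sum.elim (fun A => A.1.vecMulLinear.graph) (fun U => (ℓ U).submodule.prod U.1)
  have hCDC := isCDC_range (fun i => (f i).comap e.toLinearMap) (k := r + 1) (t := 1)
    (M := Nat.card F ^ (2 * (v - (r + 1))) + N) ?_ ?_ (by omega) ?_
  · refine ⟨_, hCDC, Set.range fun A : R => (f (Sum.inl A)).comap e.toLinearMap, ?_, R, ?_, ?_⟩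
    · rintro _ ⟨A, rfl⟩
      exact ⟨Sum.inl A, rfl⟩
    · have h : 2 * r / 2 = r + 1 - 1 := by omega
      rw [h]
      exact hR
    · ext U
      constructor
      · rintro ⟨A, rfl⟩
        exact ⟨A, A.2, (rowSpan_identityPrefix hkv _).symm⟩
      · rintro ⟨A, hA, rfl⟩
        exact ⟨⟨A, hA⟩, (rowSpan_identityPrefix hkv _).symm⟩
  · rintro (A | U)
    · rw [finrank_comap_equiv]
      exact (finrank_graph A.1.vecMulLinear).trans (Module.finrank_fin_fun F)
    · rw [finrank_comap_equiv]
      change Module.finrank F ↥((ℓ U).submodule.prod U.1) = _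
      rw [finrank_submodule_prod, Projectivization.finrank_submodule, hD.finrank_eq U.1 U.2,
        add_comm]
  · rintro (A | U) (B | W) hne <;> rw [← Submodule.comap_inf, finrank_comap_equiv]
    · refine (finrank_graph_inf_graph_le _ _).trans ?_
      have hsub : A.1.vecMulLinear - B.1.vecMulLinear = (A.1 - B.1).vecMulLinear := by
        ext x
        simp
      rw [hsub]
      exact finrank_ker_vecMulLinear_le_one (hR.le_rank _ A.2 _ B.2 fun h => hne (by rw [Subtype.ext h]))
    · exact (finrank_graph_inf_prod_le _ _ _).trans (ℓ W).finrank_submodule.le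
    · rw [inf_comm]
      exact (finrank_graph_inf_prod_le _ _ _).trans (ℓ U).finrank_submodule.le
    · have hUW : U ≠ W := fun h => hne (by rw [h])
      change Module.finrank F ↥((ℓ U).submodule.prod U.1 ⊓ (ℓ W).submodule.prod W.1) ≤ 1
      rw [Submodule.prod_inf_prod, finrank_submodule_prod,
        projectivization_submodule_inf_eq_bot (fun h => hUW (ℓ.injective h)), finrank_bot]
      have h1 := hD.le_dist U.1 U.2 W.1 W.2 fun h => hUW (Subtype.ext h)
      have h2 := subspaceDist_add_two_mul_finrank_inf (hD.finrank_eq U.1 U.2)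
        (hD.finrank_eq W.1 W.2)
      omega
  · rw [Nat.card_sum, Nat.card_coe_set_eq, hD.ncard_eq, hR.card_eq, max_eq_right hv,
      min_eq_left hv]
    have h : r + 1 + 1 - (r + 1 - 1) = 2 := by omega
    rw [h, mul_comm]

/-! ### Upper bound for the dual spread -/

/-- Counting the nonzero vectors of subspaces of `H` which pairwise meet trivially. -/
theorem sum_card_add_one_le {ι W : Type*} [AddCommGroup W] [Module F W] [Finite W]
    (s : Finset ι) (T : ι → Submodule F W) (H : Submodule F W) (hT : ∀ i ∈ s, T i ≤ H)
    (hdisj : ∀ i ∈ s, ∀ j ∈ s, i ≠ j → T i ⊓ T j = ⊥) :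
    ∑ i ∈ s, Nat.card (T i) + 1 ≤ Nat.card H + s.card := by
  classical
  have := Fintype.ofFinite W
  let N : Submodule F W → Finset W := fun U => Finset.univ.filter fun x => x ∈ U ∧ x ≠ 0
  have hN : ∀ U : Submodule F W, Nat.card U = (N U).card + 1 := by
    intro U
    have h : Finset.univ.filter (fun x => x ∈ U) = insert 0 (N U) := by
      ext x
      by_cases hx : x = 0 <;> simp [N, hx]
    rw [← Finset.card_insert_of_notMem (a := (0 : W)) (by simp [N]), ← h,
      Nat.card_eq_fintype_card, Fintype.card_subtype]
  have hsub : s.biUnion (fun i => N (T i)) ⊆ N H := by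
    intro x hx
    simp only [N, Finset.mem_biUnion, Finset.mem_filter, Finset.mem_univ, true_and] at hx ⊢
    obtain ⟨i, hi, hxi, hx0⟩ := hx
    exact ⟨hT i hi hxi, hx0⟩
  have hcard := Finset.card_le_card hsub
  rw [Finset.card_biUnion] at hcard
  · rw [Finset.sum_congr rfl fun i _ => hN (T i), Finset.sum_add_distrib, hN H]
    simp only [Finset.sum_const, smul_eq_mul, mul_one]
    omega
  · intro i hi j hj hij
    rw [Function.onFun, Finset.disjoint_left]
    intro x hxi hxj
    simp only [N, Finset.mem_filter, Finset.mem_univ, true_and] at hxi hxj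
    have h : x ∈ T i ⊓ T j := ⟨hxi.1, hxj.1⟩
    rw [hdisj i hi j hj hij] at h
    exact hxi.2 h

section DualSpread

variable [Finite F] {X : Type*} [AddCommGroup X] [Module F X] [FiniteDimensional F X]

/-- At most `q` members of a large family of `(m + 1)`-dimensional subspaces which pairwise span a
space of dimension `2 m + 1` contain a given nonzero vector. -/
theorem card_filter_mem_le {m : ℕ} (hm : 2 ≤ m) (hX : Module.finrank F X = 2 * m + 1)
    (s : Finset (Submodule F X)) (hs : ∀ U ∈ s, Module.finrank F U = m + 1)
    (hsup : ∀ U ∈ s, ∀ W ∈ s, U ≠ W → U ⊔ W = ⊤)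
    (hcard : Nat.card F ^ (m + 1) + 2 ≤ s.card) (p : X) (hp : p ≠ 0)
    [DecidablePred fun U : Submodule F X => p ∈ U] :
    (s.filter fun U => p ∈ U).card ≤ Nat.card F := by
  have hq : 2 ≤ Nat.card F := Finite.one_lt_card
  have : Finite (Module.Dual F X) := Module.finite_of_finite F
  have hline : Module.finrank F (Submodule.span F {p}) = 1 := finrank_span_singleton hp
  -- Dually, the annihilators of the `U + ⟨p⟩` meet trivially inside the hyperplane annihilating
  -- `p`; those with `p ∈ U` have dimension `m`, the others at least `m - 1`.
  have hcount := sum_card_add_one_le s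
    (fun U => (U ⊔ Submodule.span F {p}).dualAnnihilator)
    (Submodule.span F {p}).dualAnnihilator
    (fun U _ => Submodule.dualAnnihilator_anti le_sup_right)
    (fun U hU W hW hne => by
      rw [← Submodule.dualAnnihilator_sup_eq, sup_sup_sup_comm, hsup U hU W hW hne, top_sup_eq,
        Submodule.dualAnnihilator_top])
  have hH : Nat.card (Submodule.span F {p}).dualAnnihilator = Nat.card F ^ (2 * m) := by
    rw [Module.natCard_eq_pow_finrank (K := F)]
    have := Subspace.finrank_add_finrank_dualAnnihilator_eq (Submodule.span F {p})
    congr 1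
    omega
  have hlow : ∀ U ∈ s, (if p ∈ U then Nat.card F ^ m else Nat.card F ^ (m - 1)) ≤
      Nat.card (U ⊔ Submodule.span F {p}).dualAnnihilator := by
    intro U hU
    rw [Module.natCard_eq_pow_finrank (K := F)
      (V := (U ⊔ Submodule.span F {p}).dualAnnihilator)]
    have h1 := Subspace.finrank_add_finrank_dualAnnihilator_eq (U ⊔ Submodule.span F {p})
    have h2 := hs U hU
    split_ifs with hpU
    · rw [sup_eq_left.2 ((Submodule.span_singleton_le_iff_mem p U).2 hpU)] at h1 ⊢
      exact Nat.pow_le_pow_right (by omega) (by omega)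
    · have h3 := Submodule.finrank_add_le_finrank_add_finrank U (Submodule.span F {p})
      exact Nat.pow_le_pow_right (by omega) (by omega)
  have hsum := Finset.sum_le_sum hlow
  rw [Finset.sum_ite, Finset.sum_const, Finset.sum_const, smul_eq_mul, smul_eq_mul] at hsum
  have hsplit := Finset.card_filter_add_card_filter_not (s := s) (fun U => p ∈ U)
  rw [hH] at hcount
  generalize (s.filter fun U => p ∈ U).card = a at *
  generalize (s.filter fun U => p ∉ U).card = b at *
  generalize s.card = M at *
  obtain ⟨n, rfl⟩ : ∃ n, m = n + 1 := ⟨m - 1, by omega⟩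
  have hQ : 2 ≤ Nat.card F ^ n :=
    hq.trans (Nat.le_self_pow (by omega) _)
  rw [Nat.add_sub_cancel] at hsum
  generalize Nat.card F = q at *
  have e1 : q ^ (n + 1) = q * q ^ n := by ring
  have e2 : q ^ (n + 1 + 1) = q ^ 2 * q ^ n := by ring
  have e3 : q ^ (2 * (n + 1)) = q ^ 2 * (q ^ n) ^ 2 := by ring
  rw [e1] at hsum
  rw [e2] at hcard
  rw [e3] at hcount
  generalize q ^ n = Q at *
  by_contra! ha
  have h1 : a * (q * Q) + b * Q + 1 ≤ q ^ 2 * Q ^ 2 + M := by omega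
  subst hsplit
  zify at *
  -- With `Q = q ^ (m - 1)`, the count reads `a (q - 1) Q + M (Q - 1) ≤ q² Q² - 1`. Inserting `a ≥ q
  -- + 1` and `M ≥ q² Q + 2` leaves `Q ≤ 1`, which `m ≥ 2` excludes.
  nlinarith [mul_le_mul_of_nonneg_right (show (q : ℤ) + 1 ≤ a from ha)
    (mul_nonneg (show (0 : ℤ) ≤ (q : ℤ) - 1 by linarith) (show (0 : ℤ) ≤ Q by linarith)),
    mul_le_mul_of_nonneg_right hcard (show (0 : ℤ) ≤ (Q : ℤ) - 1 by linarith)]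

/-- A family of `(m + 1)`-dimensional subspaces of a space of dimension `2 m + 1` which pairwise
span the whole space has at most `q ^ (m + 1) + 1` members. -/
theorem card_le_of_sup_eq_top {m : ℕ} (hm : 2 ≤ m) (hX : Module.finrank F X = 2 * m + 1)
    (s : Finset (Submodule F X)) (hs : ∀ U ∈ s, Module.finrank F U = m + 1)
    (hsup : ∀ U ∈ s, ∀ W ∈ s, U ≠ W → U ⊔ W = ⊤) :
    s.card ≤ Nat.card F ^ (m + 1) + 1 := by
  classical
  by_contra! hcard
  have hq : 2 ≤ Nat.card F := Finite.one_lt_card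
  have : Finite X := Module.finite_of_finite F
  have := Fintype.ofFinite X
  have hdouble := Finset.sum_card_bipartiteAbove_eq_sum_card_bipartiteBelow
    (fun (U : Submodule F X) (p : X) => p ∈ U) (s := s) (t := Finset.univ)
  have hleft : ∀ U ∈ s, (Finset.univ.bipartiteAbove
      (fun (U : Submodule F X) (p : X) => p ∈ U) U).card = Nat.card F ^ (m + 1) := by
    intro U hU
    rw [Finset.bipartiteAbove, ← Fintype.card_subtype, ← Nat.card_eq_fintype_card]
    exact (Module.natCard_eq_pow_finrank (K := F) (V := U)).trans (by rw [hs U hU])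
  rw [Finset.sum_congr rfl hleft, Finset.sum_const, smul_eq_mul,
    ← Finset.add_sum_erase _ _ (Finset.mem_univ (0 : X))] at hdouble
  have hzero : (s.bipartiteBelow (fun (U : Submodule F X) (p : X) => p ∈ U) 0).card ≤ s.card :=
    Finset.card_filter_le _ _
  have hright : ∑ p ∈ Finset.univ.erase (0 : X),
      (s.bipartiteBelow (fun (U : Submodule F X) (p : X) => p ∈ U) p).card ≤
      (Finset.univ.erase (0 : X)).card * Nat.card F := by
    rw [← smul_eq_mul]
    exact Finset.sum_le_card_nsmul _ _ _ fun p hp =>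
      card_filter_mem_le hm hX s hs hsup hcard p (Finset.ne_of_mem_erase hp)
  have hcardX : (Finset.univ.erase (0 : X)).card + 1 = Nat.card F ^ (2 * m + 1) := by
    rw [Finset.card_erase_add_one (Finset.mem_univ _), Finset.card_univ,
      ← Nat.card_eq_fintype_card, Module.natCard_eq_pow_finrank (K := F), hX]
  generalize (Finset.univ.erase (0 : X)).card = N at *
  have h1 : s.card * Nat.card F ^ (m + 1) ≤ s.card + N * Nat.card F := by omega
  generalize s.card = M at *
  generalize Nat.card F = q at *
  have e1 : q ^ (2 * m + 1) * q = q ^ (m + 1) * q ^ (m + 1) := by ring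
  have hQ : 2 ≤ q ^ (m + 1) := hq.trans (Nat.le_self_pow (by omega) _)
  rw [← hcardX] at e1
  generalize q ^ (m + 1) = Q at *
  have h2 : Q + 2 ≤ M := hcard
  zify at *
  -- Counting incidences with nonzero vectors gives `M (Q - 1) ≤ Q² - q`, whereas `M ≥ Q + 2` makes
  -- the left side at least `Q² + Q - 2`.
  nlinarith [mul_le_mul_of_nonneg_right h2 (show (0 : ℤ) ≤ (Q : ℤ) - 1 by linarith)]

end DualSpread

/-- For `m = 1` the value would be `q² + q + 1`, as any two planes of `F ^ 3` meet in a line; this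
is where `l ≥ 1` enters. -/
theorem maxCDC_dual_spread (F : Type*) [Field F] [Finite F] {m : ℕ} (hm : 2 ≤ m) :
    maxCDC F (2 * m + 1) (2 * m) (m + 1) = Nat.card F ^ (m + 1) + 1 := by
  refine le_antisymm ?_ ((isGreatest_maxCDC F _ _ _).2 (exists_isCDC_dual_spread F (by omega)))
  obtain ⟨C, hC⟩ := (isGreatest_maxCDC F (2 * m + 1) (2 * m) (m + 1)).1
  have hfin : C.Finite := by
    have : Finite (Submodule F (Fin (2 * m + 1) → F)) :=
      Finite.of_injective (fun U => (U : Set (Fin (2 * m + 1) → F))) SetLike.coe_injective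
    exact Set.toFinite C
  rw [← hC.ncard_eq, Set.ncard_eq_toFinset_card C hfin]
  refine card_le_of_sup_eq_top hm (Module.finrank_fin_fun F) _ ?_ ?_
  · intro U hU
    exact hC.finrank_eq U (hfin.mem_toFinset.1 hU)
  · intro U hU W hW hne
    rw [Set.Finite.mem_toFinset] at hU hW
    have h1 := hC.finrank_eq U hU
    have h2 := hC.finrank_eq W hW
    have h3 := Submodule.finrank_sup_add_finrank_inf_eq U W
    have h4 := subspaceDist_add_two_mul_finrank_inf h1 h2
    have h5 := hC.le_dist U hU W hW hne
    have h6 := Submodule.finrank_le (U ⊔ W)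
    rw [Module.finrank_fin_fun] at h6
    apply Submodule.eq_top_of_finrank_eq
    rw [Module.finrank_fin_fun]
    omega

/-! ### The LMRD bound -/

/-- The graphs of the matrices of a maximum rank distance code with minimum rank distance `δ` cover
every subspace of dimension `k - δ + 1` on which the projection to `F ^ k` is injective. -/
theorem IsMRD.exists_le_graph [Finite F] {k n δ : ℕ} (hδk : δ ≤ k) (hkn : k ≤ n)
    {R : Submodule F (Matrix (Fin k) (Fin n) F)} (hR : IsMRD F k n δ R)
    (T : Submodule F ((Fin k → F) × (Fin n → F))) (hT : Module.finrank F T = k - δ + 1)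
    (hinj : ∀ p ∈ T, p.1 = 0 → p = 0) :
    ∃ A ∈ R, T ≤ A.vecMulLinear.graph := by
  -- Restriction to `T` is injective, since a nonzero matrix of `R` has left kernel of dimension at
  -- most `k - δ`. Both sides have `q ^ (n (k - δ + 1))` elements, so the second projection of `T`
  -- is itself attained.
  let Ψ : R →ₗ[F] T →ₗ[F] (Fin n → F) :=
    { toFun := fun A => A.1.vecMulLinear.comp ((LinearMap.fst F _ _).comp T.subtype)
      map_add' := fun A B => by ext x : 1; simp
      map_smul' := fun c A => by ext x : 1; simp }
  have hΨ : Function.Injective Ψ := by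
    rw [injective_iff_map_eq_zero]
    intro A hA
    by_contra hne
    have h1 := hR.le_rank A.1 A.2 0 R.zero_mem fun h => hne (Subtype.ext h)
    rw [sub_zero] at h1
    have h2 := rank_add_finrank_ker_vecMulLinear A.1
    have h3 := finrank_le_of_injOn (LinearMap.fst F _ _) T (LinearMap.ker A.1.vecMulLinear)
      (fun p hp => LinearMap.congr_fun hA ⟨p, hp⟩) hinj
    omega
  have hcard : Nat.card R = Nat.card (T →ₗ[F] (Fin n → F)) := by
    rw [hR.card_eq, Module.natCard_eq_pow_finrank (K := F) (V := T →ₗ[F] (Fin n → F)),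
      Module.finrank_linearMap, hT, Module.finrank_fin_fun, max_eq_right hkn, min_eq_left hkn,
      mul_comm]
    congr 2
    omega
  have : Finite (T →ₗ[F] (Fin n → F)) := Module.finite_of_finite F
  have hbij : Function.Bijective Ψ := (Nat.bijective_iff_injective_and_card _).2 ⟨hΨ, hcard⟩
  obtain ⟨A, hA⟩ := hbij.2 ((LinearMap.snd F _ _).comp T.subtype)
  refine ⟨A.1, A.2, fun p hp => ?_⟩
  rw [LinearMap.mem_graph_iff]
  exact (LinearMap.congr_fun hA ⟨p, hp⟩).symm

/-- A subspace of `F ^ k × F ^ n` of dimension `k` meets the second factor in dimension at least `δ`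
or shares a subspace of dimension `k - δ + 1` with the graph of a matrix of the code. -/
theorem IsMRD.le_finrank_comap_inr_or [Finite F] {k n δ : ℕ} (hδk : δ ≤ k)
    (hkn : k ≤ n) {R : Submodule F (Matrix (Fin k) (Fin n) F)} (hR : IsMRD F k n δ R)
    (U : Submodule F ((Fin k → F) × (Fin n → F))) (hU : Module.finrank F U = k) :
    δ ≤ Module.finrank F (U.comap (LinearMap.inr F (Fin k → F) (Fin n → F))) ∨
      ∃ A ∈ R, k - δ + 1 ≤ Module.finrank F ↥(U ⊓ A.vecMulLinear.graph) := by
  rw [or_iff_not_imp_left, not_le]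
  intro hlt
  let g : U →ₗ[F] (Fin k → F) := (LinearMap.fst F _ _).comp U.subtype
  -- If the intersection with the second factor is small, a complement of it in `U` has dimension at
  -- least `k - δ + 1` and projects injectively to `F ^ k`.
  obtain ⟨Z, hZ⟩ := Submodule.exists_isCompl (LinearMap.ker g)
  have h1 := Submodule.finrank_add_eq_of_isCompl hZ
  have h2 : Module.finrank F (LinearMap.ker g) ≤
      Module.finrank F (U.comap (LinearMap.inr F (Fin k → F) (Fin n → F))) := by
    refine finrank_le_of_injOn ((LinearMap.snd F _ _).comp U.subtype) _ _ ?_ ?_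
    · rintro ⟨⟨x, y⟩, hxy⟩ hx
      obtain rfl : x = 0 := hx
      exact hxy
    · rintro ⟨⟨x, y⟩, hxy⟩ hx hy
      obtain rfl : x = 0 := hx
      obtain rfl : y = 0 := hy
      rfl
  obtain ⟨T, hTZ, hT⟩ := exists_le_finrank_eq Z (t := k - δ + 1) (by omega)
  obtain ⟨A, hA, hle⟩ := hR.exists_le_graph hδk hkn (T.map U.subtype)
    (by rw [Submodule.finrank_map_subtype_eq, hT]) (by
      rintro _ ⟨p, hp, rfl⟩ hp0
      have h : p ∈ LinearMap.ker g ⊓ Z := ⟨hp0, hTZ hp⟩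
      rw [hZ.inf_eq_bot, Submodule.mem_bot] at h
      rw [h, map_zero])
  refine ⟨A, hA, ?_⟩
  rw [← hT, ← Submodule.finrank_map_subtype_eq]
  exact Submodule.finrank_mono (le_inf (Submodule.map_subtype_le U T) hle)

/-- The upper bound for constant dimension codes which contain a lifted maximum rank distance
code. -/
theorem IsCDC.le_lmrdBound [Finite F] {v k δ M : ℕ} (hδk : δ ≤ k)
    (hkv : 2 * k ≤ v) (hkd : k < 2 * δ) {C L : Set (Submodule F (Fin v → F))}
    (hC : IsCDC F v M (2 * δ) k C) (hLC : L ⊆ C) (hL : IsLMRD F v (2 * δ) k L) :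
    M ≤ lmrdBound F v (2 * δ) k := by
  obtain ⟨R, hR, hLR⟩ := hL
  have hfin : Finite (Submodule F (Fin v → F)) :=
    Finite.of_injective (fun U => (U : Set (Fin v → F))) SetLike.coe_injective
  have hkv' : k ≤ v := by omega
  have hkn : k ≤ v - k := by omega
  have hhalf : 2 * δ / 2 = δ := by omega
  rw [hhalf] at hR
  have hLcard : L.ncard ≤ Nat.card F ^ ((v - k) * (k - δ + 1)) := by
    have himage : L = (fun A => rowSpan (identityPrefix v k A)) '' (R : Set _) := by
      rw [hLR]
      ext U
      exact ⟨fun ⟨A, hA, h⟩ => ⟨A, hA, h.symm⟩, fun ⟨A, hA, h⟩ => ⟨A, hA, h.symm⟩⟩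
    have h : k + 1 - δ = k - δ + 1 := by omega
    have hRcard := hR.card_eq
    rw [max_eq_right hkn, min_eq_left hkn, h] at hRcard
    rw [himage, ← hRcard]
    exact Set.ncard_image_le (Set.toFinite _)
  let e := splitAt (F := F) hkv'
  let D : Submodule F (Fin v → F) → Submodule F (Fin (v - k) → F) := fun U =>
    (U.comap e.symm.toLinearMap).comap (LinearMap.inr F (Fin k → F) (Fin (v - k) → F))
  have hD : ∀ U : ↥(C \ L), δ ≤ Module.finrank F (D U) := by
    rintro ⟨U, hUC, hUL⟩
    refine (hR.le_finrank_comap_inr_or hδk hkn (U.comap e.symm.toLinearMap)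
      ((finrank_comap_equiv _ _).trans (hC.finrank_eq U hUC))).resolve_right ?_
    rintro ⟨A, hA, h⟩
    have hAL : rowSpan (identityPrefix v k A) ∈ L := by
      rw [hLR]
      exact ⟨A, hA, rfl⟩
    have hne : U ≠ rowSpan (identityPrefix v k A) := fun hU => hUL (hU ▸ hAL)
    have h1 := hC.le_dist U hUC _ (hLC hAL) hne
    have h2 := subspaceDist_add_two_mul_finrank_inf (hC.finrank_eq U hUC)
      (hC.finrank_eq _ (hLC hAL))
    have h3 : U.comap e.symm.toLinearMap ⊓ A.vecMulLinear.graph =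
        (U ⊓ rowSpan (identityPrefix v k A)).comap e.symm.toLinearMap := by
      rw [rowSpan_identityPrefix hkv', Submodule.comap_inf, ← Submodule.comap_comp,
        LinearEquiv.comp_symm, Submodule.comap_id]
    rw [h3, finrank_comap_equiv] at h
    omega
  choose H hHD hH using fun U : ↥(C \ L) => exists_le_finrank_eq (D U) (hD U)
  -- `k < 2 δ` gives `k - δ < δ`, so distinct codewords yield distinct `H U`.
  have hCDC := isCDC_range H hH (t := k - δ) (M := (C \ L).ncard) ?_ (by omega)
    (Nat.card_coe_set_eq _)
  · have hmax := (isGreatest_maxCDC F (v - k) (2 * (2 * δ - k)) δ).2 ⟨_, by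
      have h : δ - (k - δ) = 2 * δ - k := by omega
      rwa [h] at hCDC⟩
    have hsum := Set.ncard_sdiff_add_ncard_of_subset hLC (Set.toFinite C)
    rw [hC.ncard_eq] at hsum
    unfold lmrdBound
    rw [hhalf]
    omega
  · intro U W hne
    have h1 : Module.finrank F ↥(H U ⊓ H W) ≤ Module.finrank F ↥(U.1 ⊓ W.1) := by
      refine finrank_le_of_injOn (e.symm.toLinearMap.comp (LinearMap.inr F _ _)) _ _ ?_ ?_
      · exact fun x hx => ⟨hHD U hx.1, hHD W hx.2⟩
      · intro x _ hx
        have h : (0, x) = (0 : (Fin k → F) × (Fin (v - k) → F)) :=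
          e.symm.injective (hx.trans (map_zero e.symm).symm)
        exact congrArg Prod.snd h
    have h2 := hC.le_dist U.1 U.2.1 W.1 W.2.1 fun h => hne (Subtype.ext h)
    have h3 := subspaceDist_add_two_mul_finrank_inf (hC.finrank_eq U.1 U.2.1)
      (hC.finrank_eq W.1 W.2.1)
    omega

end SubspaceCode

theorem mainTheorem5 (F : Type*) [Field F] [Finite F] (q l : ℕ) (hq : Nat.card F = q)
    (hl : 1 ≤ l) :
    -- a code with these parameters that contains an LMRD code exists
    (∃ C : Set (Submodule F (Fin (6 + 3 * l) → F)),
      SubspaceCode.IsCDC F (6 + 3 * l) (q ^ (6 + 4 * l) + q ^ (2 + l) + 1) (4 + 2 * l) (3 + l) C ∧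
      ∃ L ⊆ C, SubspaceCode.IsLMRD F (6 + 3 * l) (4 + 2 * l) (3 + l) L) ∧
    -- its cardinality equals the LMRD bound
    q ^ (6 + 4 * l) + q ^ (2 + l) + 1 =
      SubspaceCode.lmrdBound F (6 + 3 * l) (4 + 2 * l) (3 + l) ∧
    -- the value of the second summand of the bound
    SubspaceCode.maxCDC F (3 + 2 * l) (2 + 2 * l) (2 + l) = q ^ (2 + l) + 1 ∧
    -- the LMRD bound is an upper bound for all codes that contain an LMRD code
    (∀ (M : ℕ) (C : Set (Submodule F (Fin (6 + 3 * l) → F))),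
      SubspaceCode.IsCDC F (6 + 3 * l) M (4 + 2 * l) (3 + l) C →
      (∃ L ⊆ C, SubspaceCode.IsLMRD F (6 + 3 * l) (4 + 2 * l) (3 + l) L) →
      M ≤ SubspaceCode.lmrdBound F (6 + 3 * l) (4 + 2 * l) (3 + l)) := by
  subst hq
  have hmax : SubspaceCode.maxCDC F (3 + 2 * l) (2 + 2 * l) (2 + l) = Nat.card F ^ (2 + l) + 1 := by
    have h := SubspaceCode.maxCDC_dual_spread F (m := l + 1) (by omega)
    convert h using 2 <;> ring
  refine ⟨?_, ?_, hmax, ?_⟩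
  · have hn : 6 + 3 * l - (2 + l + 1) = 2 * (l + 1) + 1 := by omega
    obtain ⟨D, hD⟩ : ∃ D : Set (Submodule F (Fin (6 + 3 * l - (2 + l + 1)) → F)),
        SubspaceCode.IsCDC F (6 + 3 * l - (2 + l + 1)) (Nat.card F ^ (2 + l) + 1)
          (2 * (2 + l - 1)) (2 + l) D := by
      rw [hn]
      have h := SubspaceCode.exists_isCDC_dual_spread F (m := l + 1) (by omega)
      have h1 : 2 + l - 1 = l + 1 := by omega
      have h2 : 2 + l = l + 1 + 1 := by omega
      rw [h1, h2]
      exact h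
    have h := SubspaceCode.exists_isCDC_extending_isLMRD (v := 6 + 3 * l) (r := 2 + l) (by omega)
      (by omega) hD (SubspaceCode.pow_add_one_le_card_projectivization F (by omega))
    have h1 : 2 * (6 + 3 * l - (2 + l + 1)) = 6 + 4 * l := by omega
    have h2 : 2 * (2 + l) = 4 + 2 * l := by omega
    have h3 : 2 + l + 1 = 3 + l := by omega
    rw [h1, h2, h3, ← add_assoc] at h
    exact h
  · have h1 : (6 + 3 * l - (3 + l)) * (3 + l - (4 + 2 * l) / 2 + 1) = 6 + 4 * l := by
      have h2 : 6 + 3 * l - (3 + l) = 3 + 2 * l := by omega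
      have h3 : 3 + l - (4 + 2 * l) / 2 + 1 = 2 := by omega
      rw [h2, h3]
      ring
    have h2 : 6 + 3 * l - (3 + l) = 3 + 2 * l := by omega
    have h3 : 2 * (4 + 2 * l - (3 + l)) = 2 + 2 * l := by omega
    have h4 : (4 + 2 * l) / 2 = 2 + l := by omega
    rw [SubspaceCode.lmrdBound, h1, h2, h3, h4, hmax, add_assoc]
  · rintro M C hC ⟨L, hLC, hL⟩
    have h : 4 + 2 * l = 2 * (2 + l) := by ring
    rw [h] at hC hL ⊢
    exact hC.le_lmrdBound (by omega) (by omega) (by omega) hLC hL
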